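/- Let $R$ be an associative ring with $1$ and let $I$ be a two-sided ideal of $R$. For a right $R$-module $P$ let $\mathrm{Tr}(P)=\sum_{f\in \mathrm{Hom}_R(P,R)} f(P)$ denote its trace ideal. A product $AB$ of left ideals denotes the additive subgroup generated by all products $ab$ with $a\in A$, $b\in B$. The following statements are equivalent: (i) There exists a projective right $R$-module $P$ such that $I=\mathrm{Tr}(P)$. (ii) For every finite subset $X$ of $I$ there exist finitely generated left ideals $J_1\le J_2\le I$ such that $X\subseteq J_1$ and $J_2J_1=J_1$. (iii) There exists a left ideal $J\le I$ such that $JR=I$ and such that for every finite subset $X$ of $J$ there exist finitely generated left ideals $J_1\le J_2\le J$ with $X\subseteq J_1$ and $J_2J_1=J_1$. Moreover, when these equivalent statements hold, $I$ is an $\aleph_1$-directed union of ideals of the form $\bigcup_{n\ge 1}J_nR$, where $J_1\le J_2\le\cdots\le J_n\le\cdots$ is a sequence of finitely generated left ideals such that $J_{n+1}J_n=J_n$ for every $n\ge 1$. That is, there is a set $\mathcal S$ of ideals of this form, with union $I$, such that every countable subset of $\mathcal S$ has an upper bound in $\mathcal S$ with respect to inclusion. -/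

import Mathlib

universe u v

/-- The trace `Tr(P) = ∑ f(P)`, the sum being over all `f ∈ Hom_R(P, R)`, of a right `R`-module `P`
(that is, a module over `Rᵐᵒᵖ`). The sum of the images is a right ideal, and it is also
closed under left multiplication, so it is recorded as an `Ideal R` (a left ideal of `R`); see
`isTwoSided_rightTrace` for closure on the right. -/
def rightTrace (R P : Type*) [Ring R] [AddCommGroup P] [Module Rᵐᵒᵖ P] : Ideal R where
  toAddSubmonoid := (⨆ f : P →ₗ[Rᵐᵒᵖ] R, LinearMap.range f : Submodule Rᵐᵒᵖ R).toAddSubmonoid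
  smul_mem' c x hx := by
    change c * x ∈ (⨆ f : P →ₗ[Rᵐᵒᵖ] R, LinearMap.range f : Submodule Rᵐᵒᵖ R)
    replace hx : x ∈ (⨆ f : P →ₗ[Rᵐᵒᵖ] R, LinearMap.range f : Submodule Rᵐᵒᵖ R) := hx
    induction hx using Submodule.iSup_induction' with
    | mem f x hx =>
      obtain ⟨p, rfl⟩ := hx
      let g : P →ₗ[Rᵐᵒᵖ] R :=
        { toFun := fun q => c * f q
          map_add' := fun a b => by rw [map_add, mul_add]
          map_smul' := fun r a => by
            rw [map_smul]
            simp [MulOpposite.smul_eq_mul_unop, mul_assoc] }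
      exact Submodule.mem_iSup_of_mem g ⟨p, rfl⟩
    | zero => simp
    | add x y _ _ hx hy => rw [mul_add]; exact add_mem hx hy

theorem isTwoSided_rightTrace (R P : Type*) [Ring R] [AddCommGroup P] [Module Rᵐᵒᵖ P] :
    (rightTrace R P).IsTwoSided :=
  ⟨fun {_} b ha =>
    (⨆ f : P →ₗ[Rᵐᵒᵖ] R, LinearMap.range f : Submodule Rᵐᵒᵖ R).smul_mem (MulOpposite.op b) ha⟩

/-- A set `S` of ideals is `ℵ₁`-directed under inclusion: every countable subset of `S` (including
the empty one, so `S` is nonempty) has an upper bound that lies in `S`. -/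
def IsAlephOneDirected {R : Type*} [Ring R] (S : Set (Ideal R)) : Prop :=
  ∀ T : Set (Ideal R), T ⊆ S → T.Countable → ∃ K ∈ S, ∀ L ∈ T, L ≤ K

/-- `K` is of the form `⋃ n, J n R` for a sequence `J 0 ≤ J 1 ≤ ⋯` of finitely generated left ideals
with `J (n + 1) J n = J n` for every `n`. Here `J n * ⊤` is the product `J n R`. -/
def IsUnionOfIdempotentChain {R : Type*} [Ring R] (K : Ideal R) : Prop :=
  ∃ J : ℕ → Ideal R, Monotone J ∧ (∀ n, (J n).FG) ∧ (∀ n, J (n + 1) * J n = J n) ∧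
    (K : Set R) = ⋃ n, ((J n * ⊤ : Ideal R) : Set R)

/-!
For a projective right module `P` and a finite subset `F`, the values `f p` with `p ∈ F` and
`f : P → R` linear generate a left ideal `valueIdeal R F`, which is finitely generated by the dual
basis lemma. Expanding `f p = ∑ q, f q * φ q p` in the dual basis gives
`valueIdeal R F' * valueIdeal R F = valueIdeal R F` for a finite `F' ⊇ F`. These left ideals exhaust
the trace, so the trace has the property `HasLocalLeftIdentities`.

Conversely, this property of `J` yields, above every finite subset of `J`, a chain of finitely
generated left ideals with `J (n + 1) J n = J n` (`HasLocalLeftIdentities.exists_chain`), and such a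
chain comes from a projective module. To see this, choose finite sets `C n` in `J n R` such that
every element of `C n` is a left linear combination of products of an element of `C (n + 1)` and an
element of `C n`. Multiplication by the column with entries `C n`, repeated along the diagonal, is a
map `F n` of free right modules, and `G n ∘ F (n + 1) ∘ F n = F n` for suitable `G n`. The limit of
a sequence with this property is projective (`splitLimit.projective`): the maps `F n` extend to the
limit, so the identity of the limit factors through a free module on the image of each term, and
these factorisations can be telescoped. The trace of the limit is generated by the `C n`
(`exists_projective_isLeast_rightTrace`). A direct sum over all finite subsets of `J` then has trace
`J R`.

The chains also give the `ℵ₁`-directed union: a chain can be chosen to dominate any given sequence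
of finitely generated left ideals below `I`, in particular the terms of countably many chains.
-/

/-! ### Projectivity of a module exhausted by images of a projective module -/

section Telescoping

variable {S L A : Type*} [Ring S] [AddCommGroup L] [Module S L] [AddCommGroup A] [Module S A]

/-- The product `(1 - πₙ₋₁) ⋯ (1 - π₁) (1 - π₀)`, where `πₖ` is the endomorphism
`ι (k + 1) ∘ σ k` of `L`. -/
def telescopeRemainder (ι : ℕ → A →ₗ[S] L) (σ : ℕ → L →ₗ[S] A) : ℕ → L →ₗ[S] L
  | 0 => LinearMap.id
  | n + 1 => telescopeRemainder ι σ n - ι (n + 1) ∘ₗ σ n ∘ₗ telescopeRemainder ι σ n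

variable {ι : ℕ → A →ₗ[S] L} {σ : ℕ → L →ₗ[S] A}

/-- The products `telescopeRemainder` telescope, since two consecutive ones differ by
`ι (n + 1) ∘ σ n ∘ telescopeRemainder ι σ n`. -/
theorem sum_range_telescope (N : ℕ) (x : L) :
    ∑ n ∈ Finset.range N, ι (n + 1) (σ n (telescopeRemainder ι σ n x)) =
      x - telescopeRemainder ι σ N x := by
  induction N with
  | zero => simp [telescopeRemainder]
  | succ N ih => rw [Finset.sum_range_succ, ih]; simp [telescopeRemainder, sub_add]

theorem telescopeRemainder_mem_range
    (hι : Monotone fun n => LinearMap.range (ι n)) {m n k : ℕ} {x : L}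
    (hx : x ∈ LinearMap.range (ι m)) (hm : m ≤ n) (hk : k ≤ n) :
    telescopeRemainder ι σ k x ∈ LinearMap.range (ι n) := by
  induction k with
  | zero => exact hι hm hx
  | succ k ih => exact sub_mem (ih (by omega)) (hι hk (LinearMap.mem_range_self _ _))

theorem telescopeRemainder_eq_zero
    (hι : Monotone fun n => LinearMap.range (ι n))
    (hσ : ∀ n a, ι (n + 1) (σ n (ι n a)) = ι n a) {m k : ℕ} {x : L}
    (hx : x ∈ LinearMap.range (ι m)) (hk : m < k) :
    telescopeRemainder ι σ k x = 0 := by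
  obtain ⟨k, rfl⟩ : ∃ j, k = j + 1 := ⟨k - 1, by omega⟩
  obtain ⟨a, ha⟩ := telescopeRemainder_mem_range (σ := σ) hι hx (Nat.le_of_lt_succ hk) le_rfl
  simp [telescopeRemainder, ← ha, hσ]

/-- A module exhausted by the images of `ι n : A → L`, with `A` projective, is projective as soon
as on the image of `ι n` the identity factors through `ι (n + 1)` by a map defined on all of `L`.
Telescoping the products `telescopeRemainder` writes the identity of `L` as a pointwise finite sum
of maps factoring through `A`. -/
theorem Module.Projective.of_exhaustion [Module.Projective S A]
    (hι : Monotone fun n => LinearMap.range (ι n)) (hL : ∀ x, ∃ n, x ∈ LinearMap.range (ι n))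
    (hσ : ∀ n a, ι (n + 1) (σ n (ι n a)) = ι n a) : Module.Projective S L := by
  have hfin : ∀ x, ∃ N, ∀ k, N ≤ k → telescopeRemainder ι σ k x = 0 := fun x =>
    let ⟨m, hm⟩ := hL x
    ⟨m + 1, fun k hk => telescopeRemainder_eq_zero hι hσ hm hk⟩
  have hsupp : ∀ x, {n | σ n (telescopeRemainder ι σ n x) ≠ 0}.Finite := fun x => by
    obtain ⟨N, hN⟩ := hfin x
    refine (Set.finite_lt_nat N).subset fun n hn => ?_
    by_contra h
    exact hn (by simp [hN n (not_lt.mp h)])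
  let s : L →ₗ[S] (ℕ →₀ A) :=
    { toFun x := Finsupp.ofSupportFinite (fun n => σ n (telescopeRemainder ι σ n x)) (hsupp x)
      map_add' x y := Finsupp.ext fun n => by
        change σ n _ = σ n _ + σ n _
        simp
      map_smul' r x := Finsupp.ext fun n => by
        change σ n _ = r • σ n _
        simp }
  have hs : ∀ x n, s x n = σ n (telescopeRemainder ι σ n x) := fun _ _ => rfl
  classical
  have : Module.Projective S (ℕ →₀ A) :=
    Module.Projective.of_equiv (finsuppLequivDFinsupp S).symm
  refine Module.Projective.of_split s (Finsupp.lsum ℕ fun n => ι (n + 1))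
    (LinearMap.ext fun x => ?_)
  obtain ⟨N, hN⟩ := hfin x
  have hsub : (s x).support ⊆ Finset.range N := fun n hn => by
    by_contra h
    exact Finsupp.mem_support_iff.mp hn
      (by simp [hs, hN n (by simpa using h)])
  have hsum := sum_range_telescope (ι := ι) (σ := σ) N x
  rw [hN N le_rfl, sub_zero] at hsum
  simpa [Finsupp.sum_of_support_subset _ hsub, hs] using hsum

end Telescoping

/-! ### Direct limits of sequences that split after one step -/

section Limit

variable {S A : Type*} [Ring S] [AddCommGroup A] [Module S A]

/-- For sequences `F`, `G` of endomorphisms of `A`, the map `F n ∘ ⋯ ∘ F m` if `m ≤ n` and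
`G n ∘ ⋯ ∘ G (m - 1) ∘ F m` if `n ≤ m`. -/
def transition : (F G : ℕ → A →ₗ[S] A) → ℕ → ℕ → A →ₗ[S] A
  | F, _, 0, 0 => F 0
  | F, G, 0, m + 1 => G 0 ∘ₗ transition (fun k => F (k + 1)) (fun k => G (k + 1)) 0 m
  | F, G, n + 1, 0 => transition (fun k => F (k + 1)) (fun k => G (k + 1)) n 0 ∘ₗ F 0
  | F, G, n + 1, m + 1 => transition (fun k => F (k + 1)) (fun k => G (k + 1)) n m

theorem transition_self (F G : ℕ → A →ₗ[S] A) (n : ℕ) : transition F G n n = F n := by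
  induction n generalizing F G with
  | zero => rw [transition]
  | succ n ih => rw [transition, ih]

theorem transition_succ_comp (F G : ℕ → A →ₗ[S] A)
    (h : ∀ n, G n ∘ₗ F (n + 1) ∘ₗ F n = F n) (n m : ℕ) :
    transition F G n (m + 1) ∘ₗ F m = transition F G n m := by
  induction n generalizing F G m with
  | zero =>
    induction m generalizing F G with
    | zero =>
      rw [transition, transition, transition, LinearMap.comp_assoc]
      exact h 0
    | succ m ih =>
      rw [transition, LinearMap.comp_assoc]
      conv_rhs => rw [transition]
      exact congrArg (G 0 ∘ₗ ·) (ih (fun k => F (k + 1)) (fun k => G (k + 1)) fun k => h (k + 1))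
  | succ n ih =>
    cases m with
    | zero => rw [transition, transition]
    | succ m =>
      rw [transition, transition]
      exact ih (fun k => F (k + 1)) (fun k => G (k + 1)) (fun k => h (k + 1)) m

/-- The direct limit of `A → A → ⋯` with transition maps `F n`, provided that
`G n ∘ F (n + 1) ∘ F n = F n` for all `n`. It is realised inside `ℕ → A` as the union of the
ranges of the maps `a ↦ (transition F G n m a)ₙ`. -/
def splitLimit (F G : ℕ → A →ₗ[S] A) : Submodule S (ℕ → A) :=
  ⨆ m, LinearMap.range (LinearMap.pi fun n => transition F G n m)

/-- The canonical map from the `m`-th term of the sequence to `splitLimit F G`. -/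
def splitLimit.of (F G : ℕ → A →ₗ[S] A) (m : ℕ) : A →ₗ[S] splitLimit F G :=
  (LinearMap.pi fun n => transition F G n m).codRestrict _ fun a =>
    Submodule.mem_iSup_of_mem m ⟨a, rfl⟩

/-- The `n`-th coordinate `splitLimit F G → A`. It restricts to `F n` on the `n`-th term, by
`splitLimit.coord_of`. -/
def splitLimit.coord (F G : ℕ → A →ₗ[S] A) (n : ℕ) : splitLimit F G →ₗ[S] A :=
  LinearMap.proj n ∘ₗ (splitLimit F G).subtype

namespace splitLimit

variable {F G : ℕ → A →ₗ[S] A}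

theorem coord_of (n : ℕ) (a : A) : coord F G n (of F G n a) = F n a :=
  congrArg (· a) (transition_self F G n)

theorem of_succ_apply (h : ∀ n, G n ∘ₗ F (n + 1) ∘ₗ F n = F n) (m : ℕ) (a : A) :
    of F G (m + 1) (F m a) = of F G m a :=
  Subtype.ext <| funext fun n => congrArg (· a) (transition_succ_comp F G h n m)

theorem monotone_range_of (h : ∀ n, G n ∘ₗ F (n + 1) ∘ₗ F n = F n) :
    Monotone fun m => LinearMap.range (of F G m) := by
  refine monotone_nat_of_le_succ fun m => ?_
  rintro _ ⟨a, rfl⟩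
  exact ⟨F m a, of_succ_apply h m a⟩

theorem exists_of (h : ∀ n, G n ∘ₗ F (n + 1) ∘ₗ F n = F n) (x : splitLimit F G) :
    ∃ m a, of F G m a = x := by
  have hmono : Monotone fun m => LinearMap.range (LinearMap.pi fun n => transition F G n m) := by
    refine monotone_nat_of_le_succ fun m => ?_
    rintro _ ⟨a, rfl⟩
    exact ⟨F m a, congrArg Subtype.val (of_succ_apply h m a)⟩
  obtain ⟨m, a, ha⟩ := (Submodule.mem_iSup_of_directed _ hmono.directed_le).mp x.2
  exact ⟨m, a, Subtype.ext ha⟩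

theorem projective [Module.Projective S A] (h : ∀ n, G n ∘ₗ F (n + 1) ∘ₗ F n = F n) :
    Module.Projective S (splitLimit F G) :=
  Module.Projective.of_exhaustion (σ := coord F G) (monotone_range_of h) (exists_of h)
    fun n a => by rw [coord_of, of_succ_apply h]

end splitLimit

end Limit

/-! ### Trace ideals -/

section Trace

variable {R : Type*} [Ring R]

theorem apply_mem_rightTrace {P : Type*} [AddCommGroup P] [Module Rᵐᵒᵖ P]
    (f : P →ₗ[Rᵐᵒᵖ] R) (p : P) : f p ∈ rightTrace R P :=
  Submodule.mem_iSup_of_mem (p := fun f : P →ₗ[Rᵐᵒᵖ] R => LinearMap.range f) f ⟨p, rfl⟩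

theorem rightTrace_induction {P : Type*} [AddCommGroup P] [Module Rᵐᵒᵖ P] {motive : R → Prop}
    (apply : ∀ (f : P →ₗ[Rᵐᵒᵖ] R) p, motive (f p)) (zero : motive 0)
    (add : ∀ x y, motive x → motive y → motive (x + y)) {x : R} (hx : x ∈ rightTrace R P) :
    motive x :=
  Submodule.iSup_induction (fun f : P →ₗ[Rᵐᵒᵖ] R => LinearMap.range f) (motive := motive) hx
    (by rintro f _ ⟨p, rfl⟩; exact apply f p) zero add

theorem rightTrace_le_iff {P : Type*} [AddCommGroup P] [Module Rᵐᵒᵖ P] {K : Ideal R} :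
    rightTrace R P ≤ K ↔ ∀ (f : P →ₗ[Rᵐᵒᵖ] R) p, f p ∈ K :=
  ⟨fun h f p => h (apply_mem_rightTrace f p), fun h _ hx =>
    rightTrace_induction h K.zero_mem (fun _ _ => K.add_mem) hx⟩

/-- A retract has the smaller trace. -/
theorem rightTrace_le_of_leftInverse {P Q : Type*} [AddCommGroup P] [Module Rᵐᵒᵖ P]
    [AddCommGroup Q] [Module Rᵐᵒᵖ Q] (i : P →ₗ[Rᵐᵒᵖ] Q) (s : Q →ₗ[Rᵐᵒᵖ] P)
    (h : Function.LeftInverse s i) : rightTrace R P ≤ rightTrace R Q :=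
  rightTrace_le_iff.mpr fun f p => by simpa [h p] using apply_mem_rightTrace (f ∘ₗ s) (i p)

theorem rightTrace_directSum_le {α : Type*} {P : α → Type*} [∀ a, AddCommGroup (P a)]
    [∀ a, Module Rᵐᵒᵖ (P a)] {K : Ideal R} (h : ∀ a, rightTrace R (P a) ≤ K) :
    rightTrace R (DirectSum α P) ≤ K := by
  classical
  refine rightTrace_le_iff.mpr fun f p => ?_
  induction p using DirectSum.induction_on with
  | zero => simp
  | of a p => exact h a (apply_mem_rightTrace (f ∘ₗ DirectSum.lof Rᵐᵒᵖ α P a) p)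
  | add p q hp hq => rw [map_add]; exact K.add_mem hp hq

theorem le_rightTrace_directSum {α : Type*} {P : α → Type*} [∀ a, AddCommGroup (P a)]
    [∀ a, Module Rᵐᵒᵖ (P a)] (a : α) : rightTrace R (P a) ≤ rightTrace R (DirectSum α P) := by
  classical
  exact rightTrace_le_of_leftInverse (DirectSum.lof Rᵐᵒᵖ α P a)
    (DirectSum.component Rᵐᵒᵖ α P a) fun p => DirectSum.component.lof_self _ _ p

end Trace

/-! ### The projective module of a sequence of finite sets -/

section Column

open MulOpposite
open scoped Pointwise

variable {R : Type u} [Ring R]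

/-- The endomorphism `e_w ↦ ∑ c ∈ C, e_{c :: w} c` of the free right `R`-module on the words in
elements of `R`: the column with entries `C`, repeated along the diagonal. -/
noncomputable def columnMap (C : Finset R) : (List R →₀ Rᵐᵒᵖ) →ₗ[Rᵐᵒᵖ] (List R →₀ Rᵐᵒᵖ) :=
  Finsupp.linearCombination Rᵐᵒᵖ fun w => ∑ c ∈ C, Finsupp.single (c :: w) (op c)

theorem columnMap_single (C : Finset R) (w : List R) (r : Rᵐᵒᵖ) :
    columnMap C (Finsupp.single w r) = ∑ c ∈ C, Finsupp.single (c :: w) (r * op c) := by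
  simp [columnMap, Finset.smul_sum]

/-- If every element of `C` is a left linear combination of products `d * c`, with `d ∈ D` and
`c ∈ C`, then the composite of the column maps of `C` and `D` can be cancelled down to the column
map of `C`. -/
theorem exists_comp_columnMap_comp_columnMap {C D : Finset R}
    (h : ∀ c ∈ C, c ∈ Ideal.span ((D : Set R) * (C : Set R))) :
    ∃ G : (List R →₀ Rᵐᵒᵖ) →ₗ[Rᵐᵒᵖ] (List R →₀ Rᵐᵒᵖ),
      G ∘ₗ columnMap D ∘ₗ columnMap C = columnMap C := by
  have h' : ∀ i, ∃ N : R → R → R, i ∈ C → ∑ c ∈ C, ∑ d ∈ D, N d c * (d * c) = i := by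
    intro i
    by_cases hi : i ∈ C
    · have := h i hi
      rw [← Set.image_mul_prod, ← Finset.coe_product, Ideal.span,
        Submodule.mem_span_image_finset_iff_exists_fun'] at this
      obtain ⟨N, hN⟩ := this
      exact ⟨fun d c => N (d, c), fun _ => by rw [← hN, Finset.sum_product_right]; rfl⟩
    · exact ⟨0, fun h => (hi h).elim⟩
  choose N hN using h'
  refine ⟨Finsupp.linearCombination Rᵐᵒᵖ fun
    | d :: c :: w => ∑ i ∈ C, Finsupp.single (i :: w) (op (N i d c))
    | _ => 0, Finsupp.lhom_ext fun w r => ?_⟩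
  simp only [LinearMap.comp_apply, columnMap_single, map_sum, Finsupp.linearCombination_single,
    Finset.smul_sum, Finsupp.smul_single, smul_eq_mul]
  rw [Finset.sum_congr (s₁ := C) rfl fun c _ => Finset.sum_comm, Finset.sum_comm]
  refine Finset.sum_congr rfl fun i hi => ?_
  simp only [mul_assoc, ← op_mul]
  let φ : R →+ (List R →₀ Rᵐᵒᵖ) := (Finsupp.singleAddHom (i :: w)).comp
    ((AddMonoidHom.mulLeft r).comp opAddEquiv.toAddMonoidHom)
  have hφ := congrArg φ (hN i hi)
  simp only [map_sum] at hφ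
  exact hφ

/-- If the elements of each `C n` are left linear combinations of products of an element of
`C (n + 1)` and an element of `C n`, then the two-sided ideal generated by all the `C n` is the
trace of a projective right module: the limit of the column maps of the `C n`. -/
theorem exists_projective_isLeast_rightTrace (C : ℕ → Finset R)
    (h : ∀ n, ∀ c ∈ C n, c ∈ Ideal.span ((C (n + 1) : Set R) * (C n : Set R))) :
    ∃ (P : Type u) (_ : AddCommGroup P) (_ : Module Rᵐᵒᵖ P), Module.Projective Rᵐᵒᵖ P ∧
      IsLeast {K : Ideal R | K.IsTwoSided ∧ ∀ n, (C n : Set R) ⊆ K} (rightTrace R P) := by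
  choose G hG using fun n => exists_comp_columnMap_comp_columnMap (h n)
  let F n := columnMap (C n)
  refine ⟨splitLimit F G, inferInstance, inferInstance, splitLimit.projective hG,
    ⟨isTwoSided_rightTrace _ _, fun n c hc => ?_⟩, ?_⟩
  -- `c` is a value of the functional reading off the coordinate of the word `[c]` at stage `n`.
  · let f : splitLimit F G →ₗ[Rᵐᵒᵖ] Rᵐᵒᵖ := Finsupp.lapply [c] ∘ₗ splitLimit.coord F G n
    let g : splitLimit F G →ₗ[Rᵐᵒᵖ] R :=
      { toFun x := (f x).unop
        map_add' x y := by simp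
        map_smul' r x := by simp [MulOpposite.smul_eq_mul_unop] }
    have hg : g (splitLimit.of F G n (Finsupp.single [] 1)) = c := by
      simp only [g, f, F, LinearMap.coe_mk, AddHom.coe_mk, LinearMap.comp_apply,
        splitLimit.coord_of, columnMap_single]
      rw [map_sum, Finset.unop_sum, Finset.sum_eq_single_of_mem c hc]
      · simp
      · intro b _ hb
        simp [hb]
    have := apply_mem_rightTrace g (splitLimit.of F G n (Finsupp.single [] 1))
    rwa [hg] at this
  · rintro K ⟨hK, hCK⟩
    refine rightTrace_le_iff.mpr fun f x => ?_
    obtain ⟨m, a, rfl⟩ := splitLimit.exists_of hG x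
    -- Moving one stage up the sequence brings in a factor from `C m`.
    rw [← splitLimit.of_succ_apply hG]
    induction a using Finsupp.induction_linear with
    | zero => simp
    | add a b ha hb => simpa only [map_add] using K.add_mem ha hb
    | single w r =>
      simp only [F, columnMap_single, map_sum]
      refine K.sum_mem fun c hc => ?_
      have hs : Finsupp.single (c :: w) (r * op c) =
          r • op c • (Finsupp.single (c :: w) 1 : List R →₀ Rᵐᵒᵖ) := by simp
      rw [hs, map_smul, map_smul, map_smul, map_smul]
      exact K.mul_mem_right _ (K.mul_mem_left _ (hCK m hc))

end Column

/-! ### Chains of finitely generated left ideals -/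

section Chain

open scoped Pointwise

variable {R : Type u} [Ring R]

theorem span_mul_span_le_span_mul_univ_mul (A B : Set R) :
    Ideal.span B * Ideal.span A ≤ Ideal.span (B * Set.univ * A) := by
  refine Ideal.mul_le.mpr fun x hx y hy => ?_
  induction hx using Submodule.span_induction with
  | zero => simp
  | add x₁ x₂ _ _ h₁ h₂ => rw [add_mul]; exact add_mem h₁ h₂
  | smul r x _ h => rw [smul_mul_assoc]; exact Submodule.smul_mem _ r h
  | mem b hb =>
    induction hy using Submodule.closure_induction with
    | zero => simp
    | add y₁ y₂ _ _ h₁ h₂ => rw [mul_add]; exact add_mem h₁ h₂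
    | smul_mem r a ha =>
      rw [smul_eq_mul, ← mul_assoc]
      exact Ideal.subset_span (Set.mul_mem_mul (Set.mul_mem_mul hb trivial) ha)

/-- If `J' J = J` for left ideals generated by finite sets `B` and `A`, then finitely many middle
factors suffice to write the elements of `A` in terms of the products `b * r * a`. -/
theorem exists_finset_subset_span_mul {A B : Finset R}
    (h : Ideal.span (B : Set R) * Ideal.span (A : Set R) = Ideal.span (A : Set R)) :
    ∃ D : Finset R, ∀ a ∈ A, a ∈ Ideal.span ((B : Set R) * (D : Set R) * (A : Set R)) := by
  classical
  have key : ∀ a ∈ A, ∃ D : Finset R,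
      a ∈ Ideal.span ((B : Set R) * (D : Set R) * (A : Set R)) := by
    intro a ha
    have hx : a ∈ Ideal.span (A : Set R) := Ideal.subset_span ha
    rw [← h] at hx
    obtain ⟨T, hT, hxT⟩ :=
      Submodule.mem_span_finite_of_mem_span (span_mul_span_le_span_mul_univ_mul _ _ hx)
    obtain ⟨T₁, T₂, hT₁, hT₂, hT⟩ := Finset.subset_mul hT
    obtain ⟨B', D, hB', -, hT₁⟩ := Finset.subset_mul hT₁
    refine ⟨D, Ideal.span_mono ((Finset.coe_subset.mpr hT).trans ?_) hxT⟩
    rw [Finset.coe_mul]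
    refine Set.mul_subset_mul ((Finset.coe_subset.mpr hT₁).trans ?_) hT₂
    rw [Finset.coe_mul]
    exact Set.mul_subset_mul_right hB'
  choose! D hD using key
  refine ⟨A.biUnion D, fun a ha => Ideal.span_mono ?_ (hD a ha)⟩
  exact Set.mul_subset_mul_right (Set.mul_subset_mul_left
    (Finset.coe_subset.mpr (Finset.subset_biUnion_of_mem D ha)))

theorem mul_mem_span_mul_singleton {S : Set R} {x : R} (hx : x ∈ Ideal.span S) (r : R) :
    x * r ∈ Ideal.span (S * {r}) := by
  induction hx using Submodule.span_induction with
  | zero => simp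
  | add x y _ _ h₁ h₂ => rw [add_mul]; exact add_mem h₁ h₂
  | smul s x _ h => rw [smul_mul_assoc]; exact Submodule.smul_mem _ s h
  | mem b hb => exact Ideal.subset_span (Set.mul_mem_mul hb rfl)

/-- A chain of finitely generated left ideals `J n` with `J (n + 1) J n = J n` yields a projective
module whose trace contains `J 0` and stays inside every two-sided ideal containing the chain. -/
theorem exists_projective_of_chain (J : ℕ → Ideal R) (hfg : ∀ n, (J n).FG)
    (hJ : ∀ n, J (n + 1) * J n = J n) {I : Ideal R} [I.IsTwoSided] (hI : ∀ n, J n ≤ I) :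
    ∃ (P : Type u) (_ : AddCommGroup P) (_ : Module Rᵐᵒᵖ P), Module.Projective Rᵐᵒᵖ P ∧
      rightTrace R P ≤ I ∧ J 0 ≤ rightTrace R P := by
  classical
  choose A hA using hfg
  have hA' : ∀ n, Ideal.span (A n : Set R) = J n := hA
  choose D hD using fun n => exists_finset_subset_span_mul (A := A n) (B := A (n + 1))
    (by rw [hA', hA', hJ])
  -- The generators of `J (n + 1)` are multiplied on the right by the middle factors that occur when
  -- `J n` is written as `J (n + 1) J n`.
  let E : ℕ → Finset R := fun n => Nat.casesOn n {1} D
  obtain ⟨P, _, _, hP, ⟨-, hle⟩, hge⟩ := exists_projective_isLeast_rightTrace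
    (fun n => A n * E n) fun n c hc => by
      obtain ⟨a, ha, r, hr, rfl⟩ := Finset.mem_mul.mp hc
      refine Ideal.span_mono ?_ (mul_mem_span_mul_singleton (hD n a ha) r)
      rw [Finset.coe_mul, Finset.coe_mul, mul_assoc]
      exact Set.mul_subset_mul_left (Set.mul_subset_mul_left (Set.singleton_subset_iff.mpr hr))
  refine ⟨P, inferInstance, inferInstance, hP, hge ⟨inferInstance, fun n c hc => ?_⟩, ?_⟩
  · obtain ⟨a, ha, r, -, rfl⟩ := Finset.mem_mul.mp hc
    exact I.mul_mem_right r (hI n (hA' n ▸ Ideal.subset_span ha))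
  · rw [← hA', Ideal.span_le]
    simpa [E] using hle 0

/-- The property of `J` in which every finite subset of `J` lies in a finitely generated left ideal
`J₁` with `J₂ J₁ = J₁`, for some finitely generated `J₂` between `J₁` and `J`. -/
def HasLocalLeftIdentities (J : Ideal R) : Prop :=
  ∀ X : Finset R, (X : Set R) ⊆ J →
    ∃ J₁ J₂ : Ideal R, J₁.FG ∧ J₂.FG ∧ J₁ ≤ J₂ ∧ J₂ ≤ J ∧ (X : Set R) ⊆ J₁ ∧ J₂ * J₁ = J₁

/-- Chains with `K (n + 1) K n = K n` can be found above any sequence of finitely generated left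
ideals below `J`. -/
theorem HasLocalLeftIdentities.exists_chain {J : Ideal R} (h : HasLocalLeftIdentities J)
    (B : ℕ → Ideal R) (hBfg : ∀ n, (B n).FG) (hB : ∀ n, B n ≤ J) :
    ∃ K : ℕ → Ideal R, Monotone K ∧ (∀ n, (K n).FG) ∧ (∀ n, K n ≤ J) ∧ (∀ n, B n ≤ K n) ∧
      ∀ n, K (n + 1) * K n = K n := by
  have step : ∀ M : Ideal R, M.FG → M ≤ J → ∃ J₁ J₂ : Ideal R,
      J₁.FG ∧ J₂.FG ∧ J₁ ≤ J₂ ∧ J₂ ≤ J ∧ M ≤ J₁ ∧ J₂ * J₁ = J₁ := by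
    rintro M ⟨X, rfl⟩ hM
    obtain ⟨J₁, J₂, h₁, h₂, h₁₂, h₂J, hX, hmul⟩ := h X (Submodule.span_le.mp hM)
    exact ⟨J₁, J₂, h₁, h₂, h₁₂, h₂J, Submodule.span_le.mpr hX, hmul⟩
  choose! p q hp hq hpq hqJ hMp hmul using step
  -- `K n` is the left ideal `J₁` provided for `M n`. Since `M (n + 1)` contains the corresponding
  -- `J₂`, so does `K (n + 1)`.
  let M : ℕ → Ideal R := fun n => Nat.rec (B 0) (fun n M => q M ⊔ B (n + 1)) n
  have hM : ∀ n, (M n).FG ∧ M n ≤ J := by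
    intro n
    induction n with
    | zero => exact ⟨hBfg 0, hB 0⟩
    | succ n ih => exact ⟨Submodule.FG.sup (hq _ ih.1 ih.2) (hBfg _),
        sup_le (hqJ _ ih.1 ih.2) (hB _)⟩
  have hqM : ∀ n, q (M n) ≤ p (M (n + 1)) := fun n =>
    (le_sup_left (b := B (n + 1))).trans (hMp _ (hM (n + 1)).1 (hM (n + 1)).2)
  refine ⟨fun n => p (M n), monotone_nat_of_le_succ fun n =>
      (hpq _ (hM n).1 (hM n).2).trans (hqM n),
    fun n => hp _ (hM n).1 (hM n).2,
    fun n => (hpq _ (hM n).1 (hM n).2).trans (hqJ _ (hM n).1 (hM n).2), fun n => ?_,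
    fun n => le_antisymm Ideal.mul_le_right ?_⟩
  · refine le_trans ?_ (hMp _ (hM n).1 (hM n).2)
    cases n with
    | zero => exact le_rfl
    | succ n => exact le_sup_right
  · refine (hmul _ (hM n).1 (hM n).2).symm.trans_le ?_
    exact Ideal.mul_mono (hqM n) le_rfl

end Chain

/-! ### Finitely generated left ideals attached to a projective module -/

section Projective

variable {R : Type*} [Ring R] {P : Type*} [AddCommGroup P] [Module Rᵐᵒᵖ P]

/-- The left ideal generated by the values at the elements of `F` of all functionals on `P`. -/
def valueIdeal (R : Type*) [Ring R] {P : Type*} [AddCommGroup P] [Module Rᵐᵒᵖ P] (F : Finset P) :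
    Ideal R :=
  Ideal.span {x | ∃ p ∈ F, ∃ f : P →ₗ[Rᵐᵒᵖ] R, f p = x}

theorem apply_mem_valueIdeal {F : Finset P} {p : P} (hp : p ∈ F) (f : P →ₗ[Rᵐᵒᵖ] R) :
    f p ∈ valueIdeal R F :=
  Ideal.subset_span ⟨p, hp, f, rfl⟩

theorem valueIdeal_mono {F F' : Finset P} (h : F ⊆ F') : valueIdeal R F ≤ valueIdeal R F' :=
  Ideal.span_mono fun _ ⟨p, hp, f, hf⟩ => ⟨p, h hp, f, hf⟩

theorem valueIdeal_le_rightTrace (F : Finset P) : valueIdeal R F ≤ rightTrace R P :=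
  Ideal.span_le.mpr fun _ ⟨p, _, f, hf⟩ => hf ▸ apply_mem_rightTrace f p

theorem exists_mem_valueIdeal {x : R} (hx : x ∈ rightTrace R P) :
    ∃ F : Finset P, x ∈ valueIdeal R F := by
  classical
  refine rightTrace_induction (motive := fun x => ∃ F : Finset P, x ∈ valueIdeal R F)
    (fun f p => ⟨{p}, apply_mem_valueIdeal (Finset.mem_singleton_self p) f⟩) ⟨∅, zero_mem _⟩ ?_ hx
  rintro x y ⟨F, hF⟩ ⟨F', hF'⟩
  exact ⟨F ∪ F', add_mem (valueIdeal_mono Finset.subset_union_left hF)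
    (valueIdeal_mono Finset.subset_union_right hF')⟩

/-- A dual basis of a projective right module: `p = ∑ q, q * φ q p`, a finite sum. -/
theorem exists_dualBasis [Module.Projective Rᵐᵒᵖ P] :
    ∃ φ : P → P →ₗ[Rᵐᵒᵖ] R, ∀ p, ∃ F : Finset P, ∀ f : P →ₗ[Rᵐᵒᵖ] R,
      f p = ∑ q ∈ F, f q * φ q p := by
  obtain ⟨s, hs⟩ := Module.projective_def'.mp ‹Module.Projective Rᵐᵒᵖ P›
  refine ⟨fun q =>
    { toFun p := (s p q).unop
      map_add' x y := by simp
      map_smul' r x := by simp [MulOpposite.smul_eq_mul_unop] },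
    fun p => ⟨(s p).support, fun f => ?_⟩⟩
  have hp : (s p).sum (fun q r => r • q) = p := LinearMap.congr_fun hs p
  conv_lhs => rw [← hp, Finsupp.sum, map_sum]
  exact Finset.sum_congr rfl fun q _ => by
    rw [map_smul, MulOpposite.smul_eq_mul_unop]; rfl

/-- The values of the coordinate functionals of a dual basis generate `valueIdeal R F`; only
finitely many of them are nonzero at a given element. -/
theorem valueIdeal_fg [Module.Projective Rᵐᵒᵖ P] (F : Finset P) : (valueIdeal R F).FG := by
  classical
  obtain ⟨φ, hφ⟩ := exists_dualBasis (R := R) (P := P)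
  choose T hT using hφ
  refine ⟨F.biUnion fun p => (T p).image fun q => φ q p, le_antisymm ?_ ?_⟩
  · refine Submodule.span_le.mpr fun x hx => ?_
    simp only [Finset.coe_biUnion, Finset.coe_image, Set.mem_iUnion, Set.mem_image] at hx
    obtain ⟨p, hp, q, -, rfl⟩ := hx
    exact apply_mem_valueIdeal hp (φ q)
  · refine Ideal.span_le.mpr ?_
    rintro _ ⟨p, hp, f, rfl⟩
    rw [hT p f]
    refine Submodule.sum_mem _ fun q hq => Ideal.mul_mem_left _ _ (Submodule.subset_span ?_)
    exact Finset.mem_biUnion.mpr ⟨p, hp, Finset.mem_image_of_mem _ hq⟩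

/-- Evaluating functionals on the dual basis expansion of the elements of `F` writes the generators
of `valueIdeal R F` as sums of products; `F'` adds to `F` the basis elements involved. -/
theorem exists_valueIdeal_mul_valueIdeal [Module.Projective Rᵐᵒᵖ P] (F : Finset P) :
    ∃ F' : Finset P, F ⊆ F' ∧ valueIdeal R F' * valueIdeal R F = valueIdeal R F := by
  classical
  obtain ⟨φ, hφ⟩ := exists_dualBasis (R := R) (P := P)
  choose T hT using hφ
  refine ⟨F ∪ F.biUnion T, Finset.subset_union_left, le_antisymm Ideal.mul_le_right ?_⟩
  refine Ideal.span_le.mpr ?_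
  rintro _ ⟨p, hp, f, rfl⟩
  rw [hT p f]
  refine Submodule.sum_mem _ fun q hq => Ideal.mul_mem_mul
    (apply_mem_valueIdeal (Finset.mem_union_right _ (Finset.mem_biUnion.mpr ⟨p, hp, hq⟩)) f)
    (apply_mem_valueIdeal hp (φ q))

theorem hasLocalLeftIdentities_rightTrace [Module.Projective Rᵐᵒᵖ P] :
    HasLocalLeftIdentities (rightTrace R P) := by
  classical
  intro X hX
  choose! T hT using fun (x : R) (hx : x ∈ X) => exists_mem_valueIdeal (hX hx)
  obtain ⟨F', hF', hmul⟩ := exists_valueIdeal_mul_valueIdeal (R := R) (X.biUnion T)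
  exact ⟨_, _, valueIdeal_fg _, valueIdeal_fg F', valueIdeal_mono hF', valueIdeal_le_rightTrace _,
    fun x hx => valueIdeal_mono (Finset.subset_biUnion_of_mem T hx) (hT x hx), hmul⟩

end Projective

/-! ### Ideals with local left identities as trace ideals and as directed unions -/

/-- The module is the direct sum, over the finite subsets `X` of `J`, of the projective modules
attached to a chain of left ideals that starts above `X`. -/
theorem HasLocalLeftIdentities.exists_projective {R : Type u} [Ring R] {I J : Ideal R}
    [I.IsTwoSided] (hJI : J ≤ I) (hJ : J * ⊤ = I) (h : HasLocalLeftIdentities J) :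
    ∃ (P : Type u) (_ : AddCommGroup P) (_ : Module Rᵐᵒᵖ P),
      Module.Projective Rᵐᵒᵖ P ∧ I = rightTrace R P := by
  have hP : ∀ X : {X : Finset R // (X : Set R) ⊆ J}, ∃ (P : Type u) (_ : AddCommGroup P)
      (_ : Module Rᵐᵒᵖ P), Module.Projective Rᵐᵒᵖ P ∧ rightTrace R P ≤ I ∧
        (X.1 : Set R) ⊆ rightTrace R P := fun ⟨X, hX⟩ => by
    obtain ⟨K, -, hfg, hKJ, hBK, hmul⟩ :=
      h.exists_chain (fun _ => Ideal.span X) (fun _ => ⟨X, rfl⟩) fun _ => Ideal.span_le.mpr hX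
    obtain ⟨P, i₁, i₂, hP, hle, hge⟩ :=
      exists_projective_of_chain K hfg hmul fun n => (hKJ n).trans hJI
    exact ⟨P, i₁, i₂, hP, hle, Ideal.span_le.mp ((hBK 0).trans hge)⟩
  choose P _ _ hproj hle hge using hP
  refine ⟨DirectSum _ P, inferInstance, inferInstance, inferInstance,
    le_antisymm ?_ (rightTrace_directSum_le hle)⟩
  have := isTwoSided_rightTrace R (DirectSum _ P)
  rw [← hJ, Ideal.mul_le]
  intro x hx r _
  refine Ideal.mul_mem_right r _ (le_rightTrace_directSum ⟨{x}, by simpa using hx⟩ ?_)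
  exact hge ⟨{x}, by simpa using hx⟩ (by simp)

/-- The set consists of all unions `⋃ n, J n R` of idempotent chains that lie in `I`. It is
`ℵ₁`-directed because the terms of countably many chains can be listed in one sequence, which a
single new chain dominates. -/
theorem HasLocalLeftIdentities.exists_isAlephOneDirected {R : Type*} [Ring R] {I : Ideal R}
    [I.IsTwoSided] (h : HasLocalLeftIdentities I) :
    ∃ S : Set (Ideal R), IsAlephOneDirected S ∧ (∀ K ∈ S, IsUnionOfIdempotentChain K) ∧
      (I : Set R) = ⋃ K ∈ S, (K : Set R) := by
  -- a chain dominating a given sequence of finitely generated left ideals below `I`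
  have chain : ∀ B : ℕ → Ideal R, (∀ n, (B n).FG) → (∀ n, B n ≤ I) → ∃ K : Ideal R, K ≤ I ∧
      IsUnionOfIdempotentChain K ∧ ∀ n, B n * ⊤ ≤ K := fun B hfg hB => by
    obtain ⟨M, hmono, hMfg, hMI, hBM, hmul⟩ := h.exists_chain B hfg hB
    have hmono' : Monotone fun n => M n * ⊤ := fun m n hmn => Ideal.mul_mono (hmono hmn) le_rfl
    refine ⟨⨆ n, M n * ⊤, iSup_le fun n => ?_,
      ⟨M, hmono, hMfg, hmul, Submodule.coe_iSup_of_directed _ hmono'.directed_le⟩, fun n =>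
        (Ideal.mul_mono (hBM n) le_rfl).trans (le_iSup (fun n => M n * ⊤) n)⟩
    exact (Ideal.mul_mono (hMI n) le_rfl).trans I.mul_top.le
  refine ⟨{K | K ≤ I ∧ IsUnionOfIdempotentChain K}, fun T hT hTc => ?_, fun K hK => hK.2,
    Set.Subset.antisymm (fun x hx => ?_) ?_⟩
  · have hchain : ∀ K ∈ T, IsUnionOfIdempotentChain K := fun K hK => (hT hK).2
    choose! J _ hfg _ hJ using hchain
    have hJI : ∀ K ∈ T, ∀ n, J K n ≤ I := fun K hK n x hx => (hT hK).1 <| by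
      have : x ∈ J K n * ⊤ := by simpa using Ideal.mul_mem_mul hx (Submodule.mem_top (x := (1 : R)))
      exact (hJ K hK).ge (Set.mem_iUnion.mpr ⟨n, this⟩)
    -- all terms of the chains of the members of `T`, with `⊥` in case `T` is empty
    have hc : (insert ⊥ (⋃ K ∈ T, Set.range (J K))).Countable :=
      (hTc.biUnion fun K _ => Set.countable_range _).insert _
    obtain ⟨B, hB⟩ := hc.exists_eq_range (Set.insert_nonempty _ _)
    have hB' : ∀ n, B n = ⊥ ∨ ∃ K ∈ T, ∃ m, J K m = B n := fun n => by
      have : B n ∈ insert ⊥ (⋃ K ∈ T, Set.range (J K)) := hB ▸ Set.mem_range_self n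
      simpa using this
    obtain ⟨L, hLI, hL, hBL⟩ := chain B
      (fun n => by
        rcases hB' n with h | ⟨K, hK, m, h⟩
        · exact h ▸ Submodule.fg_bot
        · exact h ▸ hfg K hK m)
      (fun n => by
        rcases hB' n with h | ⟨K, hK, m, h⟩
        · exact h ▸ bot_le
        · exact h ▸ hJI K hK m)
    refine ⟨L, ⟨hLI, hL⟩, fun K hK x hx => ?_⟩
    obtain ⟨n, hn⟩ := Set.mem_iUnion.mp ((hJ K hK).le hx)
    obtain ⟨k, hk⟩ : J K n ∈ Set.range B :=
      hB ▸ Set.mem_insert_of_mem _ (Set.mem_biUnion hK (Set.mem_range_self n))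
    exact hBL k (hk ▸ hn)
  · obtain ⟨K, hKI, hK, hBK⟩ := chain (fun _ => Ideal.span {x}) (fun _ => ⟨{x}, by simp⟩)
      fun _ => (Ideal.span_singleton_le_iff_mem I).mpr hx
    refine Set.mem_biUnion (x := K) ⟨hKI, hK⟩ (hBK 0 ?_)
    simpa using Ideal.mul_mem_mul (Ideal.mem_span_singleton_self x)
      (Submodule.mem_top (x := (1 : R)))
  · exact Set.iUnion₂_subset fun K (hK : K ≤ I ∧ _) => hK.1

/-- `Ideal R` is the type of left ideals of `R`; right `R`-modules are modules over `Rᵐᵒᵖ`. -/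
theorem proposition2p6 (R : Type u) [Ring R] (I : Ideal R) [I.IsTwoSided] :
    List.TFAE [
      (∃ (P : Type (max u v)) (_ : AddCommGroup P) (_ : Module Rᵐᵒᵖ P),
        Module.Projective Rᵐᵒᵖ P ∧ I = rightTrace R P),
      (∀ X : Finset R, (X : Set R) ⊆ I →
        ∃ J₁ J₂ : Ideal R, J₁.FG ∧ J₂.FG ∧ J₁ ≤ J₂ ∧ J₂ ≤ I ∧ (X : Set R) ⊆ J₁ ∧ J₂ * J₁ = J₁),
      (∃ J : Ideal R, J ≤ I ∧ J * ⊤ = I ∧ ∀ X : Finset R, (X : Set R) ⊆ J →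
        ∃ J₁ J₂ : Ideal R, J₁.FG ∧ J₂.FG ∧ J₁ ≤ J₂ ∧ J₂ ≤ J ∧ (X : Set R) ⊆ J₁ ∧ J₂ * J₁ = J₁)] ∧
    ((∃ (P : Type (max u v)) (_ : AddCommGroup P) (_ : Module Rᵐᵒᵖ P),
        Module.Projective Rᵐᵒᵖ P ∧ I = rightTrace R P) →
      ∃ S : Set (Ideal R), IsAlephOneDirected S ∧ (∀ K ∈ S, IsUnionOfIdempotentChain K) ∧
        (I : Set R) = ⋃ K ∈ S, (K : Set R)) := by
  have h₁₂ : (∃ (P : Type (max u v)) (_ : AddCommGroup P) (_ : Module Rᵐᵒᵖ P),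
      Module.Projective Rᵐᵒᵖ P ∧ I = rightTrace R P) → HasLocalLeftIdentities I := by
    rintro ⟨P, _, _, _, rfl⟩
    exact hasLocalLeftIdentities_rightTrace
  refine ⟨?_, fun h => (h₁₂ h).exists_isAlephOneDirected⟩
  tfae_have 1 → 2 := h₁₂
  tfae_have 2 → 3 := fun h => ⟨I, le_rfl, I.mul_top, h⟩
  tfae_have 3 → 1 := by
    rintro ⟨J, hJI, hJ, h⟩
    obtain ⟨P, _, _, _, hI⟩ := HasLocalLeftIdentities.exists_projective hJI hJ h
    let e : ULift.{v} P ≃ₗ[Rᵐᵒᵖ] P := ULift.moduleEquiv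
    exact ⟨ULift.{v} P, inferInstance, inferInstance, inferInstance, hI.trans <| le_antisymm
      (rightTrace_le_of_leftInverse e.symm.toLinearMap e.toLinearMap e.apply_symm_apply)
      (rightTrace_le_of_leftInverse e.toLinearMap e.symm.toLinearMap e.symm_apply_apply)⟩
  tfae_finish
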